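/- Let $(X,d)$ be a compact metric space with a base point $e\in X$. Let $\mathrm{Lip}_0(X)$ be the Banach space of all real-valued Lipschitz functions $f$ on $X$ with $f(e)=0$, normed by the least Lipschitz constant of $f$. For $x\in X$ let $j(x)\in \mathrm{Lip}_0(X)^*$ be the evaluation functional $j(x)(f)=f(x)$, and let the Lipschitz-free space $\mathcal F(X)=\overline{\operatorname{span}}\,\{j(x):x\in X\}\subset \mathrm{Lip}_0(X)^*$ be the norm-closed linear span of these functionals, with the dual norm. For distinct $p,q\in X$ put $$u_{pq}=\frac{j(p)-j(q)}{\|j(p)-j(q)\|}=\frac{j(p)-j(q)}{d(p,q)}\in\mathcal F(X).$$ For a normed space $Y$ let $B_Y$ denote its closed unit ball. A preserved extreme point of $B_Y$ is an extreme point of $B_Y$ whose canonical image in the bidual $Y^{**}$ is an extreme point of $B_{Y^{**}}$. Theorem. Let $p,q$ be distinct points of $X$. Then the following are equivalent: (i) $u_{pq}$ is a preserved extreme point of $B_{\mathcal F(X)}$; (ii) $u_{pq}$ is an extreme point of $B_{\mathcal F(X)}$; (iii) no point of $X$ lies strictly between $p$ and $q$, i.e. there is no $r\in X\setminus\{p,q\}$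 with $d(p,r)+d(r,q)=d(p,q)$. -/

import Mathlib

/-- `LiesStrictlyBetween p q r`: the point `r` lies strictly between `p` and `q`, i.e.
`d(p, r) + d(r, q) = d(p, q)` and `r` is neither `p` nor `q`. -/
def LiesStrictlyBetween {X : Type*} [MetricSpace X] (p q r : X) : Prop :=
  dist p r + dist r q = dist p q ∧ r ≠ p ∧ r ≠ q

/-- The vector space of real-valued Lipschitz functions on `X` vanishing at the base point `e`,
as a linear subspace of the space of all functions `X → ℝ`. -/
def lipZeroSubmodule {X : Type*} [MetricSpace X] (e : X) : Submodule ℝ (X → ℝ) where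
  carrier := {f | f e = 0 ∧ ∃ K : ℝ, 0 ≤ K ∧ ∀ x y, |f x - f y| ≤ K * dist x y}
  zero_mem' := ⟨rfl, 0, le_rfl, fun x y => by simp⟩
  add_mem' := by
    rintro f g ⟨hf, K, hK, hfK⟩ ⟨hg, M, hM, hgM⟩
    refine ⟨by simp [hf, hg], K + M, add_nonneg hK hM, fun x y => ?_⟩
    have h : (f + g) x - (f + g) y = (f x - f y) + (g x - g y) := by
      simp only [Pi.add_apply]; ring
    rw [h, add_mul]
    exact (abs_add_le _ _).trans (add_le_add (hfK x y) (hgM x y))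
  smul_mem' := by
    rintro c f ⟨hf, K, hK, hfK⟩
    refine ⟨by simp [hf], |c| * K, mul_nonneg (abs_nonneg c) hK, fun x y => ?_⟩
    have h : (c • f) x - (c • f) y = c * (f x - f y) := by
      simp only [Pi.smul_apply, smul_eq_mul]; ring
    rw [h, abs_mul, mul_assoc]
    exact mul_le_mul_of_nonneg_left (hfK x y) (abs_nonneg c)

/-- The space `Lip₀(X)` for the pointed metric space `(X, e)`. It is a type of its own, so that its
topology is the one of the Lipschitz norm and not that of pointwise convergence. -/
def LipZero {X : Type*} [MetricSpace X] (e : X) : Type _ := ↥(lipZeroSubmodule e)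

namespace LipZero

variable {X : Type*} [MetricSpace X] {e : X}

noncomputable instance : AddCommGroup (LipZero e) :=
  inferInstanceAs (AddCommGroup ↥(lipZeroSubmodule e))

noncomputable instance : Module ℝ (LipZero e) :=
  inferInstanceAs (Module ℝ ↥(lipZeroSubmodule e))

instance : CoeFun (LipZero e) (fun _ => X → ℝ) := ⟨fun f => f.1⟩

theorem ext_fun {f g : LipZero e} (h : ∀ x, f x = g x) : f = g := Subtype.ext (funext h)

theorem add_apply (f g : LipZero e) (x : X) : (f + g) x = f x + g x := rfl

theorem smul_apply (c : ℝ) (f : LipZero e) (x : X) : (c • f) x = c * f x := rfl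

theorem zero_apply (x : X) : (0 : LipZero e) x = 0 := rfl

theorem apply_base (f : LipZero e) : f e = 0 := f.2.1

/-- The norm `L(f)` of `f ∈ Lip₀(X)` is its least Lipschitz constant. -/
noncomputable instance : Norm (LipZero e) :=
  ⟨fun f => sInf {K : ℝ | 0 ≤ K ∧ ∀ x y, |f x - f y| ≤ K * dist x y}⟩

theorem norm_def (f : LipZero e) :
    ‖f‖ = sInf {K : ℝ | 0 ≤ K ∧ ∀ x y, |f x - f y| ≤ K * dist x y} := rfl

theorem norm_nonneg' (f : LipZero e) : 0 ≤ ‖f‖ :=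
  Real.sInf_nonneg fun _ hK => hK.1

theorem norm_le_of_lipschitz (f : LipZero e) {K : ℝ} (hK : 0 ≤ K)
    (h : ∀ x y, |f x - f y| ≤ K * dist x y) : ‖f‖ ≤ K :=
  csInf_le ⟨0, fun _ hM => hM.1⟩ ⟨hK, h⟩

/-- The infimum defining the norm is attained. -/
theorem abs_sub_le (f : LipZero e) (x y : X) : |f x - f y| ≤ ‖f‖ * dist x y := by
  rcases eq_or_ne x y with rfl | hxy
  · simp
  · have hd : 0 < dist x y := dist_pos.mpr hxy
    rw [← div_le_iff₀ hd]
    refine le_csInf f.2.2 fun K hK => ?_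
    rw [div_le_iff₀ hd]
    exact hK.2 x y

theorem abs_apply_le (f : LipZero e) (x : X) : |f x| ≤ dist x e * ‖f‖ := by
  have h := abs_sub_le f x e
  rwa [apply_base, sub_zero, mul_comm] at h

theorem norm_smul_le' (c : ℝ) (f : LipZero e) : ‖c • f‖ ≤ |c| * ‖f‖ := by
  refine norm_le_of_lipschitz _ (mul_nonneg (abs_nonneg c) (norm_nonneg' f)) fun x y => ?_
  rw [smul_apply, smul_apply, ← mul_sub, abs_mul, mul_assoc]
  exact mul_le_mul_of_nonneg_left (abs_sub_le f x y) (abs_nonneg c)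

theorem normedSpaceCore : NormedSpace.Core ℝ (LipZero e) where
  norm_nonneg := norm_nonneg'
  norm_smul c f := by
    rw [Real.norm_eq_abs]
    refine le_antisymm (norm_smul_le' c f) ?_
    rcases eq_or_ne c 0 with rfl | hc
    · simpa using norm_nonneg' _
    · have h := norm_smul_le' c⁻¹ (c • f)
      rw [smul_smul, inv_mul_cancel₀ hc, one_smul, abs_inv] at h
      calc |c| * ‖f‖ ≤ |c| * (|c|⁻¹ * ‖c • f‖) := mul_le_mul_of_nonneg_left h (abs_nonneg c)
        _ = ‖c • f‖ := by rw [mul_inv_cancel_left₀ (abs_ne_zero.mpr hc)]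
  norm_triangle f g := by
    refine norm_le_of_lipschitz _ (add_nonneg (norm_nonneg' f) (norm_nonneg' g)) fun x y => ?_
    have h : (f + g) x - (f + g) y = (f x - f y) + (g x - g y) := by
      rw [add_apply, add_apply]; ring
    rw [h, add_mul]
    exact (abs_add_le _ _).trans (add_le_add (abs_sub_le f x y) (abs_sub_le g x y))
  norm_eq_zero_iff f := by
    constructor
    · intro h
      refine ext_fun fun x => ?_
      have hx := abs_apply_le f x
      rw [h, mul_zero] at hx
      exact abs_nonpos_iff.mp hx
    · rintro rfl
      refine le_antisymm (norm_le_of_lipschitz _ le_rfl fun x y => ?_) (norm_nonneg' _)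
      simp [zero_apply]

noncomputable instance : NormedAddCommGroup (LipZero e) :=
  NormedAddCommGroup.ofCore normedSpaceCore

noncomputable instance : NormedSpace ℝ (LipZero e) :=
  NormedSpace.ofCore normedSpaceCore

/-- The evaluation functional `j(x) : f ↦ f x`, an element of the dual of `Lip₀(X)`. -/
noncomputable def eval (e x : X) : StrongDual ℝ (LipZero e) :=
  LinearMap.mkContinuous
    { toFun := fun f => f x
      map_add' := fun _ _ => rfl
      map_smul' := fun _ _ => rfl }
    (dist x e) fun f => abs_apply_le f x

end LipZero

/-- The Lipschitz-free space `𝓕(X)` of the pointed metric space `(X, e)`: the closed linear span of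
the evaluation functionals in the dual of `Lip₀(X)`, with the dual norm. -/
noncomputable def LipFree {X : Type*} [MetricSpace X] (e : X) :
    Submodule ℝ (StrongDual ℝ (LipZero e)) :=
  (Submodule.span ℝ (Set.range (LipZero.eval e))).topologicalClosure

/-- The canonical map `j : X → 𝓕(X)`. -/
noncomputable def LipFree.j {X : Type*} [MetricSpace X] (e x : X) : LipFree e :=
  ⟨LipZero.eval e x,
    Submodule.le_topologicalClosure _ (Submodule.subset_span (Set.mem_range_self x))⟩

/-- The elementary molecule `u_{pq} = (j(p) - j(q)) / ‖j(p) - j(q)‖` of `𝓕(X)`. -/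
noncomputable def LipFree.u {X : Type*} [MetricSpace X] (e p q : X) : LipFree e :=
  ‖LipFree.j e p - LipFree.j e q‖⁻¹ • (LipFree.j e p - LipFree.j e q)

/-- A point `x` of a real normed space `E` is a preserved extreme point of the closed unit ball of
`E` if it is an extreme point of that ball and its canonical image in the bidual `E**` is an extreme
point of the closed unit ball of `E**`. -/
def IsPreservedExtremePoint {E : Type*} [NormedAddCommGroup E] [NormedSpace ℝ E] (x : E) : Prop :=
  x ∈ Set.extremePoints ℝ (Metric.closedBall (0 : E) 1) ∧
    NormedSpace.inclusionInDoubleDual ℝ E x ∈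
      Set.extremePoints ℝ (Metric.closedBall (0 : StrongDual ℝ (StrongDual ℝ E)) 1)

/-! Extremality is proved in `Lip₀(X)*`, which contains `𝓕(X)` and through which its bidual is
tested, so one argument serves both balls. If `u_{pq}` is a convex combination of `μ` and `ν`, the
de Leeuw embedding and Hahn–Banach extend both to functionals `M`, `N` of norm at most one on `ℓ^∞(X
× X)`. Each takes the value 1 at every `f` in the unit ball with `f p - f q = d(p,q)`. When no point
lies between `p` and `q`, every other point `x₀` admits such an `f` with slopes bounded away from ±1
on pairs having a coordinate near `x₀` (`exists_nhds_map_eq_zero`). By compactness `M` only sees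
pairs with both coordinates near `p` or `q`. Near `(p,q)` and `(q,p)` slopes are continuous and
contribute a multiple of `u_{pq}`. What remains lives near `(p,p)` and `(q,q)`. A test function flat
near `p` and near `q` shows that all the mass of `M` sits on the first kind of pair, so `μ = u_{pq}`
(`eq_of_convex_combination`). Conversely, a point `r` in between makes `u_{pq}` a proper convex
combination of `u_{pr}` and `u_{rq}`. -/

/-- The Banach space `ℓ^∞(α)` of bounded real functions on `α`. -/
abbrev BddFun (α : Type*) : Type _ := lp (fun _ : α => ℝ) ⊤

/-! ### Functionals on bounded functions -/

namespace BddFun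

variable {α : Type*}

/-- A function bounded by `C`, as an element of `ℓ^∞`. -/
def ofBound (h : α → ℝ) (C : ℝ) (hC : ∀ z, |h z| ≤ C) : BddFun α :=
  ⟨h, memℓp_infty ⟨C, by rintro _ ⟨z, rfl⟩; exact hC z⟩⟩

@[simp] theorem ofBound_apply (h : α → ℝ) (C : ℝ) (hC : ∀ z, |h z| ≤ C) (z : α) :
    ofBound h C hC z = h z := rfl

theorem abs_apply_le (h : BddFun α) (z : α) : |h z| ≤ ‖h‖ :=
  lp.norm_apply_le_norm ENNReal.top_ne_zero h z

theorem norm_le {h : BddFun α} {C : ℝ} (hC : 0 ≤ C) (H : ∀ z, |h z| ≤ C) : ‖h‖ ≤ C :=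
  lp.norm_le_of_forall_le hC H

theorem ext_apply {h k : BddFun α} (H : ∀ z, h z = k z) : h = k := lp.ext (funext H)

@[simp] theorem add_apply (h k : BddFun α) (z : α) : (h + k) z = h z + k z := rfl

@[simp] theorem sub_apply (h k : BddFun α) (z : α) : (h - k) z = h z - k z := rfl

@[simp] theorem smul_apply (c : ℝ) (h : BddFun α) (z : α) : (c • h) z = c * h z := rfl

theorem exists_eq_on_and_eq_zero_off (S : Set α) (h : BddFun α) :
    ∃ k : BddFun α, (∀ z ∈ S, k z = h z) ∧ ∀ z ∉ S, k z = 0 := by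
  classical
  refine ⟨ofBound (fun z => if z ∈ S then h z else 0) ‖h‖ fun z => ?_, ?_, ?_⟩
  · split_ifs
    · exact abs_apply_le h z
    · simp
  · intro z hz
    simp [hz]
  · intro z hz
    simp [hz]

/-- A functional of norm at most one which attains its norm at `F` vanishes on every function
supported on a set on which `|F|` is bounded away from one. -/
theorem map_eq_zero_of_abs_le_one_sub {M : BddFun α →L[ℝ] ℝ} (hM : ∀ h, |M h| ≤ ‖h‖)
    {F : BddFun α} (hF : ‖F‖ ≤ 1) (hMF : M F = 1) {δ : ℝ} (hδ : 0 < δ) {h : BddFun α}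
    (hh : ∀ z, h z ≠ 0 → |F z| ≤ 1 - δ) : M h = 0 := by
  -- For small `t` of either sign, `F + t • h` stays in the unit ball, so `1 + t * M h ≤ 1`.
  have key : ∀ t : ℝ, |t| * ‖h‖ ≤ δ → t * M h ≤ 0 := by
    intro t ht
    have h1 : ‖F + t • h‖ ≤ 1 := by
      refine norm_le zero_le_one fun z => ?_
      rw [add_apply, smul_apply]
      by_cases hz : h z = 0
      · rw [hz, mul_zero, add_zero]
        exact (abs_apply_le F z).trans hF
      · have h2 : |t * h z| ≤ δ := by
          rw [abs_mul]
          exact (mul_le_mul_of_nonneg_left (abs_apply_le h z) (abs_nonneg t)).trans ht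
        linarith [abs_add_le (F z) (t * h z), hh z hz]
    have h2 := (le_abs_self _).trans ((hM (F + t • h)).trans h1)
    rw [map_add, map_smul, smul_eq_mul, hMF] at h2
    linarith
  have hpos : 0 < ‖h‖ + 1 := by positivity
  have ht : 0 < δ / (‖h‖ + 1) := by positivity
  have hle : |δ / (‖h‖ + 1)| * ‖h‖ ≤ δ := by
    rw [abs_of_pos ht, div_mul_eq_mul_div, div_le_iff₀ hpos]
    nlinarith
  have h1 := key _ hle
  have h2 := key (-(δ / (‖h‖ + 1))) (by rwa [abs_neg])
  have h3 : δ / (‖h‖ + 1) * M h = 0 := by linarith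
  exact (mul_eq_zero.mp h3).resolve_left ht.ne'

end BddFun

/-! ### The de Leeuw embedding and functions peaking on `(p, q)` -/

namespace LipZero

variable {X : Type*} [MetricSpace X] {e : X}

/-- A Lipschitz function, normalised to vanish at the base point. -/
def ofLipschitz (e : X) (f : X → ℝ) (K : ℝ) (hK : 0 ≤ K)
    (hf : ∀ x y, |f x - f y| ≤ K * dist x y) : LipZero e :=
  ⟨fun x => f x - f e, sub_self _, K, hK, fun x y => by
    rw [sub_sub_sub_cancel_right]; exact hf x y⟩

section ofLipschitz

variable (f : X → ℝ) {K : ℝ} (hK : 0 ≤ K) (hf : ∀ x y, |f x - f y| ≤ K * dist x y)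

theorem ofLipschitz_sub (x y : X) :
    ofLipschitz e f K hK hf x - ofLipschitz e f K hK hf y = f x - f y :=
  sub_sub_sub_cancel_right _ _ _

theorem norm_ofLipschitz_le : ‖ofLipschitz e f K hK hf‖ ≤ K :=
  norm_le_of_lipschitz _ hK fun x y => by rw [ofLipschitz_sub]; exact hf x y

end ofLipschitz

theorem continuous (f : LipZero e) : Continuous f :=
  (LipschitzWith.of_dist_le_mul (K := ⟨‖f‖, norm_nonneg' f⟩) (f.abs_sub_le)).continuous

theorem abs_div_dist_le (f : LipZero e) (x y : X) : |(f x - f y) / dist x y| ≤ ‖f‖ := by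
  rw [abs_div, abs_of_nonneg dist_nonneg]
  exact div_le_of_le_mul₀ dist_nonneg (norm_nonneg f) (abs_sub_le f x y)

/-- The de Leeuw map, sending a Lipschitz function to its difference quotients. -/
noncomputable def deLeeuw (e : X) : LipZero e →ₗᵢ[ℝ] BddFun (X × X) where
  -- On the diagonal the quotient is `0 / 0 = 0`, so all of `X × X` can serve as index set.
  toFun f := BddFun.ofBound (fun z => (f z.1 - f z.2) / dist z.1 z.2) ‖f‖
    fun z => abs_div_dist_le f z.1 z.2
  map_add' f g := BddFun.ext_apply fun z => by
    simp only [BddFun.ofBound_apply, add_apply, BddFun.add_apply]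
    ring
  map_smul' c f := BddFun.ext_apply fun z => by
    simp only [BddFun.ofBound_apply, smul_apply, BddFun.smul_apply, RingHom.id_apply]
    ring
  norm_map' f := by
    refine le_antisymm (BddFun.norm_le (norm_nonneg f) fun z => abs_div_dist_le f z.1 z.2) ?_
    refine norm_le_of_lipschitz f (norm_nonneg _) fun x y => ?_
    rcases eq_or_ne x y with rfl | hxy
    · simp
    · have h := BddFun.abs_apply_le (BddFun.ofBound (fun z : X × X => (f z.1 - f z.2) / dist z.1 z.2)
        ‖f‖ fun z => abs_div_dist_le f z.1 z.2) (x, y)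
      rw [BddFun.ofBound_apply, abs_div, abs_of_nonneg dist_nonneg,
        div_le_iff₀ (dist_pos.mpr hxy)] at h
      exact h

@[simp] theorem deLeeuw_apply (f : LipZero e) (x y : X) :
    deLeeuw e f (x, y) = (f x - f y) / dist x y := rfl

/-- Every functional in the unit ball of `Lip₀(X)*` factors through the de Leeuw map. -/
theorem exists_deLeeuw_extension (μ : StrongDual ℝ (LipZero e)) (hμ : ‖μ‖ ≤ 1) :
    ∃ M : BddFun (X × X) →L[ℝ] ℝ, (∀ h, |M h| ≤ ‖h‖) ∧ ∀ f, M (deLeeuw e f) = μ f := by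
  let E := (deLeeuw e).equivRange
  obtain ⟨M, hM, hMn⟩ := exists_extension_norm_eq (𝕜 := ℝ) (deLeeuw e).range
    (μ.comp (E.symm.toContinuousLinearEquiv : (deLeeuw e).range →L[ℝ] LipZero e))
  have hn : ‖M‖ ≤ 1 := by
    rw [hMn]
    refine ContinuousLinearMap.opNorm_le_bound _ zero_le_one fun z => ?_
    refine (μ.le_opNorm _).trans ?_
    have : ‖E.symm z‖ = ‖z‖ := E.symm.norm_map z
    calc ‖μ‖ * ‖E.symm z‖ ≤ 1 * ‖E.symm z‖ := by gcongr
      _ = 1 * ‖z‖ := by rw [this]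
  refine ⟨M, fun h => ?_, fun f => ?_⟩
  · calc |M h| ≤ ‖M‖ * ‖h‖ := M.le_opNorm h
      _ ≤ 1 * ‖h‖ := by gcongr
      _ = ‖h‖ := one_mul _
  · have h1 : (E f : BddFun (X × X)) = deLeeuw e f := rfl
    have h2 := hM (E f)
    rw [h1] at h2
    rw [h2]
    change μ (E.symm (E f)) = μ f
    rw [E.symm_apply_apply]

/-- The function `x ↦ max (d(p,q) - d(x,p)) (min (d(x,q)) k)`, which peaks on `(p, q)` and is
constant where `d(p,q) - d(x,p) < k < d(x,q)`. -/
noncomputable def plateau (p q : X) (k : ℝ) (x : X) : ℝ :=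
  max (dist p q - dist x p) (min (dist x q) k)

theorem abs_plateau_sub_le (p q : X) (k : ℝ) (x y : X) :
    |plateau p q k x - plateau p q k y| ≤ 1 * dist x y := by
  rw [one_mul]
  have h1 : |(dist p q - dist x p) - (dist p q - dist y p)| ≤ dist x y := by
    rw [sub_sub_sub_cancel_left, abs_sub_comm]
    exact abs_dist_sub_le x y p
  have h2 : |min (dist x q) k - min (dist y q) k| ≤ dist x y :=
    (abs_min_sub_min_le_max _ _ _ _).trans
      (max_le (abs_dist_sub_le x y q) (by simp))
  exact (abs_max_sub_max_le_max _ _ _ _).trans (max_le h1 h2)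

theorem plateau_left (p q : X) (k : ℝ) : plateau p q k p = dist p q := by
  simp [plateau]

theorem plateau_right (p q : X) (k : ℝ) (hk : 0 ≤ k) : plateau p q k q = 0 := by
  simp [plateau, dist_comm q p, hk]

/-- At `x` the value is `k` with margin `η` on both sides; a distance `η` is used up before another
term of the max-min can move the value off `k`. -/
theorem abs_plateau_sub_le_of_lt {p q : X} {k η : ℝ} {x : X} (hη : 0 ≤ η)
    (h1 : dist p q - dist x p + η < k) (h2 : k < dist x q - η) (y : X) :
    |plateau p q k x - plateau p q k y| ≤ max 0 (dist x y - η) := by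
  have hx : plateau p q k x = k := by
    rw [plateau, min_eq_right (by linarith), max_eq_right (by linarith)]
  have e1 : dist x p ≤ dist x y + dist y p := dist_triangle x y p
  have e2 : dist x q ≤ dist x y + dist y q := dist_triangle x y q
  have e3 : 0 ≤ max 0 (dist x y - η) := le_max_left _ _
  have e4 : dist x y - η ≤ max 0 (dist x y - η) := le_max_right _ _
  rw [hx, abs_sub_le_iff]
  constructor
  · have : k - max 0 (dist x y - η) ≤ plateau p q k y :=
      (le_min (by linarith) (by linarith)).trans (le_max_right _ _)
    linarith
  · have : plateau p q k y ≤ k + max 0 (dist x y - η) :=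
      max_le (by linarith) ((min_le_right _ _).trans (by linarith))
    linarith

/-- The plateau function as an element of `Lip₀(X)`. -/
noncomputable def plateauLip (e p q : X) (k : ℝ) : LipZero e :=
  ofLipschitz e (plateau p q k) 1 zero_le_one (abs_plateau_sub_le p q k)

theorem plateauLip_sub (p q : X) (k : ℝ) (x y : X) :
    plateauLip e p q k x - plateauLip e p q k y = plateau p q k x - plateau p q k y :=
  ofLipschitz_sub _ _ _ x y

theorem norm_plateauLip_le (p q : X) (k : ℝ) : ‖plateauLip e p q k‖ ≤ 1 :=
  norm_ofLipschitz_le _ _ _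

theorem plateauLip_peak (p q : X) {k : ℝ} (hk : 0 ≤ k) :
    plateauLip e p q k p - plateauLip e p q k q = dist p q := by
  rw [plateauLip_sub, plateau_left, plateau_right p q k hk, sub_zero]

/-! ### Functionals in the face see only pairs near `p` and `q` -/

section Face

variable [CompactSpace X] {p q : X} {M : BddFun (X × X) →L[ℝ] ℝ}

/-- The strict triangle inequality leaves room for a level `k` at which the plateau function is
constant near `x₀`; its slopes on pairs meeting `V` are then uniformly below one in absolute value.
-/
theorem exists_nhds_map_eq_zero (hM : ∀ h, |M h| ≤ ‖h‖)
    (hpeak : ∀ f : LipZero e, ‖f‖ ≤ 1 → f p - f q = dist p q → M (deLeeuw e f) = 1)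
    {x₀ : X} (hx₀ : dist p q < dist x₀ p + dist x₀ q) :
    ∃ V ∈ nhds x₀, ∀ h : BddFun (X × X),
      (∀ x y, x ∉ V → y ∉ V → h (x, y) = 0) → M h = 0 := by
  obtain ⟨k, hk0, hk1, hk2⟩ : ∃ k, 0 ≤ k ∧ dist p q - dist x₀ p < k ∧ k < dist x₀ q := by
    have e1 : dist p q ≤ dist x₀ p + dist x₀ q := dist_triangle_left p q x₀
    have e2 : 0 < dist x₀ q ∨ dist x₀ q = 0 := dist_nonneg.lt_or_eq.imp_right Eq.symm
    rcases e2 with e2 | e2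
    · obtain ⟨k, hk, hk'⟩ := exists_between
        (max_lt e2 (show dist p q - dist x₀ p < dist x₀ q by linarith))
      exact ⟨k, (le_max_left _ _).trans hk.le, (le_max_right _ _).trans_lt hk, hk'⟩
    · rw [dist_eq_zero.mp e2, dist_comm q p, dist_self] at hx₀
      linarith
  obtain ⟨η, hη, hη'⟩ := exists_between
    (lt_min (show 0 < k - (dist p q - dist x₀ p) by linarith)
      (show 0 < dist x₀ q - k by linarith))
  obtain ⟨hη1, hη2⟩ := lt_min_iff.mp hη'
  refine ⟨{x | dist p q - dist x p + η < k ∧ k < dist x q - η}, ?_, fun h hh => ?_⟩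
  · have o1 : IsOpen {x | dist p q - dist x p + η < k} := isOpen_lt (by fun_prop) (by fun_prop)
    have o2 : IsOpen {x | k < dist x q - η} := isOpen_lt (by fun_prop) (by fun_prop)
    exact (o1.inter o2).mem_nhds
      ⟨show dist p q - dist x₀ p + η < k by linarith, show k < dist x₀ q - η by linarith⟩
  -- The absolute gain `η` becomes a slope gap `η / D` because distances are bounded by `D`; adding
  -- `η` to the diameter ensures `0 < D` and `η / D ≤ 1`.
  · have hD : 0 < Metric.diam (Set.univ : Set X) + η :=
      add_pos_of_nonneg_of_pos Metric.diam_nonneg hη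
    have hdist : ∀ x y : X, dist x y ≤ Metric.diam (Set.univ : Set X) + η := fun x y =>
      (Metric.dist_le_diam_of_mem isCompact_univ.isBounded trivial trivial).trans
        (le_add_of_nonneg_right hη.le)
    set D := Metric.diam (Set.univ : Set X) + η
    have hηD : η ≤ D := le_add_of_nonneg_left Metric.diam_nonneg
    have hbound : ∀ x y, dist p q - dist x p + η < k ∧ k < dist x q - η →
        |plateau p q k x - plateau p q k y| / dist x y ≤ 1 - η / D := by
      intro x y hx
      have h1 : η / D ≤ 1 := (div_le_one hD).mpr hηD
      refine div_le_of_le_mul₀ dist_nonneg (by linarith)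
        ((abs_plateau_sub_le_of_lt hη.le hx.1 hx.2 y).trans
          (max_le (mul_nonneg (by linarith) dist_nonneg) ?_))
      have h2 : η / D * dist x y ≤ η := by
        rw [div_mul_eq_mul_div, div_le_iff₀ hD]
        exact mul_le_mul_of_nonneg_left (hdist x y) hη.le
      linarith
    refine BddFun.map_eq_zero_of_abs_le_one_sub hM (F := deLeeuw e (plateauLip e p q k))
      (by rw [LinearIsometry.norm_map]; exact norm_plateauLip_le p q k)
      (hpeak _ (norm_plateauLip_le p q k) (plateauLip_peak p q hk0))
      (div_pos hη hD) ?_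
    rintro ⟨x, y⟩ hxy
    rw [deLeeuw_apply, plateauLip_sub, abs_div, abs_of_nonneg dist_nonneg]
    by_cases hx : dist p q - dist x p + η < k ∧ k < dist x q - η
    · exact hbound x y hx
    · by_cases hy : dist p q - dist y p + η < k ∧ k < dist y q - η
      · rw [abs_sub_comm, dist_comm]
        exact hbound y x hy
      · exact absurd (hh x y hx hy) hxy

theorem map_eq_zero_of_eq_zero_near (hM : ∀ h, |M h| ≤ ‖h‖)
    (hpeak : ∀ f : LipZero e, ‖f‖ ≤ 1 → f p - f q = dist p q → M (deLeeuw e f) = 1)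
    (hbtw : ¬ ∃ r : X, LiesStrictlyBetween p q r) {ε : ℝ} (hε : 0 < ε) {h : BddFun (X × X)}
    (hh : ∀ x y, (dist x p < ε ∨ dist x q < ε) → (dist y p < ε ∨ dist y q < ε) → h (x, y) = 0) :
    M h = 0 := by
  have hK : IsCompact {x : X | ε ≤ dist x p ∧ ε ≤ dist x q} := by
    have c1 : IsClosed {x | ε ≤ dist x p} := isClosed_le (by fun_prop) (by fun_prop)
    have c2 : IsClosed {x | ε ≤ dist x q} := isClosed_le (by fun_prop) (by fun_prop)
    exact (c1.inter c2).isCompact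
  -- Being negligible, in the sense that `M` kills all functions supported on pairs meeting `S`,
  -- passes to subsets and finite unions and holds locally.
  have key := hK.induction_on
    (p := fun S => ∀ h : BddFun (X × X), (∀ x y, x ∉ S → y ∉ S → h (x, y) = 0) → M h = 0)
    ?_ ?_ ?_ ?_
  · refine key h fun x y hx hy => hh x y ?_ ?_
    · by_contra! hc
      exact hx hc
    · by_contra! hc
      exact hy hc
  · intro h hh
    have : h = 0 := BddFun.ext_apply fun z => hh z.1 z.2 (Set.notMem_empty _) (Set.notMem_empty _)
    rw [this, map_zero]
  · intro S T hST hT h hh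
    exact hT h fun x y hx hy => hh x y (fun h => hx (hST h)) fun h => hy (hST h)
  · intro S T hS hT h hh
    obtain ⟨k, hk, hk'⟩ := BddFun.exists_eq_on_and_eq_zero_off {z : X × X | z.1 ∈ S ∨ z.2 ∈ S} h
    have h1 : M k = 0 := hS k fun x y hx hy => hk' (x, y) (by simp [hx, hy])
    have h2 : M (h - k) = 0 := by
      refine hT _ fun x y hx hy => ?_
      rw [BddFun.sub_apply]
      by_cases hxy : (x, y) ∈ {z : X × X | z.1 ∈ S ∨ z.2 ∈ S}
      · rw [hk _ hxy, sub_self]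
      · rw [hk' _ hxy, sub_zero]
        simp only [Set.mem_ofPred_eq, not_or] at hxy
        exact hh x y (by simp [hx, hxy.1]) (by simp [hy, hxy.2])
    rw [map_sub, h1, sub_zero] at h2
    exact h2
  · intro x hx
    have hlt : dist p q < dist x p + dist x q := by
      refine lt_of_le_of_ne (dist_triangle_left p q x) fun heq => hbtw ⟨x, ?_, ?_, ?_⟩
      · rw [dist_comm p x, heq]
      · rintro rfl
        exact absurd hx.1 (by simpa using hε)
      · rintro rfl
        exact absurd hx.2 (by simpa using hε)
    obtain ⟨V, hV, hV'⟩ := exists_nhds_map_eq_zero hM hpeak hlt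
    exact ⟨V, mem_nhdsWithin_of_mem_nhds hV, hV'⟩

/-- Cutting `h` off outside a neighbourhood of `{p, q} × {p, q}` does not change `M h` and leaves a
function of norm at most `η`. -/
theorem map_eq_zero_of_small_near (hM : ∀ h, |M h| ≤ ‖h‖)
    (hpeak : ∀ f : LipZero e, ‖f‖ ≤ 1 → f p - f q = dist p q → M (deLeeuw e f) = 1)
    (hbtw : ¬ ∃ r : X, LiesStrictlyBetween p q r) {h : BddFun (X × X)}
    (hh : ∀ η > 0, ∃ ε > 0, ∀ x y, (dist x p < ε ∨ dist x q < ε) →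
      (dist y p < ε ∨ dist y q < ε) → |h (x, y)| ≤ η) :
    M h = 0 := by
  refine abs_nonpos_iff.mp (le_of_forall_gt_imp_ge_of_dense fun η hη => ?_)
  obtain ⟨ε, hε, H⟩ := hh η hη
  obtain ⟨k, hk, hk'⟩ := BddFun.exists_eq_on_and_eq_zero_off
    {z : X × X | (dist z.1 p < ε ∨ dist z.1 q < ε) ∧ (dist z.2 p < ε ∨ dist z.2 q < ε)} h
  have h1 : M (h - k) = 0 := map_eq_zero_of_eq_zero_near hM hpeak hbtw hε fun x y hx hy => by
    rw [BddFun.sub_apply, hk (x, y) ⟨hx, hy⟩, sub_self]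
  rw [map_sub, sub_eq_zero] at h1
  rw [h1]
  refine (hM k).trans (BddFun.norm_le hη.le fun z => ?_)
  by_cases hz : z ∈ {z : X × X | (dist z.1 p < ε ∨ dist z.1 q < ε) ∧
      (dist z.2 p < ε ∨ dist z.2 q < ε)}
  · rw [hk z hz]
    exact H z.1 z.2 hz.1 hz.2
  · rw [hk' z hz, abs_zero]
    exact hη.le

end Face

end LipZero

/-! ### Splitting a functional into its off-diagonal and diagonal parts -/

namespace LipZero

variable {X : Type*} [MetricSpace X] {e : X}

/-- The pairs with one point close to `p` and the other one close to `q`, in this order. -/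
def nearPair (p q : X) : Set (X × X) :=
  {z | dist z.1 p < dist p q / 3 ∧ dist z.2 q < dist p q / 3}

theorem disjoint_nearPair (p q : X) : Disjoint (nearPair p q) (nearPair q p) := by
  rw [Set.disjoint_left]
  rintro ⟨x, y⟩ ⟨h1, -⟩ ⟨h2, -⟩
  simp only at h1 h2
  rw [dist_comm q p] at h2
  linarith [dist_triangle_left p q x, dist_nonneg (x := p) (y := q)]

open Classical in
/-- The antisymmetric sign function of the pairs close to `(p, q)` or `(q, p)`. -/
noncomputable def pairSign (p q : X) : BddFun (X × X) :=
  BddFun.ofBound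
    (fun z => if z ∈ nearPair p q then 1 else if z ∈ nearPair q p then -1 else 0) 1
    fun z => by split_ifs <;> simp

theorem pairSign_of_mem {p q : X} {z : X × X} (hz : z ∈ nearPair p q) : pairSign p q z = 1 := by
  simp [pairSign, hz]

theorem pairSign_of_mem_swap {p q : X} {z : X × X} (hz : z ∈ nearPair q p) :
    pairSign p q z = -1 := by
  simp [pairSign, hz, (disjoint_nearPair p q).notMem_of_mem_right hz]

theorem pairSign_of_notMem {p q : X} {z : X × X} (hz : z ∉ nearPair p q)
    (hz' : z ∉ nearPair q p) : pairSign p q z = 0 := by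
  simp [pairSign, hz, hz']

theorem norm_pairSign_le (p q : X) : ‖pairSign p q‖ ≤ 1 := by
  refine BddFun.norm_le zero_le_one fun z => ?_
  by_cases hz : z ∈ nearPair p q
  · simp [pairSign_of_mem hz]
  · by_cases hz' : z ∈ nearPair q p
    · simp [pairSign_of_mem_swap hz']
    · simp [pairSign_of_notMem hz hz']

/-- Since `M` ignores pairs away from `p` and `q`, only the values of `T` near `(p,p)` and `(q,q)`
will matter. -/
theorem exists_diagonal_part (p q : X) (g : LipZero e) : ∃ T : BddFun (X × X),
    (∀ z ∈ nearPair p q ∪ nearPair q p, T z = 0) ∧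
      ∀ z ∉ nearPair p q ∪ nearPair q p, T z = deLeeuw e g z := by
  obtain ⟨T, h1, h2⟩ :=
    BddFun.exists_eq_on_and_eq_zero_off (nearPair p q ∪ nearPair q p)ᶜ (deLeeuw e g)
  exact ⟨T, fun z hz => h2 z (Set.notMem_compl_iff.mpr hz), fun z hz => h1 z hz⟩

section Face

variable [CompactSpace X] {p q : X} {M : BddFun (X × X) →L[ℝ] ℝ}

/-- A functional in the face of `u_{pq}` is a multiple of `u_{pq}` plus a part supported near the
diagonal. -/
theorem map_deLeeuw_eq (hpq : p ≠ q) (hM : ∀ h, |M h| ≤ ‖h‖)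
    (hpeak : ∀ f : LipZero e, ‖f‖ ≤ 1 → f p - f q = dist p q → M (deLeeuw e f) = 1)
    (hbtw : ¬ ∃ r : X, LiesStrictlyBetween p q r) (g : LipZero e) {T : BddFun (X × X)}
    (hT : ∀ z ∈ nearPair p q ∪ nearPair q p, T z = 0)
    (hT' : ∀ z ∉ nearPair p q ∪ nearPair q p, T z = deLeeuw e g z) :
    M (deLeeuw e g) = (g p - g q) / dist p q * M (pairSign p q) + M T := by
  have hc : 0 < dist p q := dist_pos.mpr hpq
  suffices h : M (deLeeuw e g - ((g p - g q) / dist p q) • pairSign p q - T) = 0 by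
    rw [map_sub, map_sub, map_smul, smul_eq_mul] at h
    linarith
  refine map_eq_zero_of_small_near hM hpeak hbtw fun η hη => ?_
  have hcont : ContinuousAt (fun z : X × X => (g z.1 - g z.2) / dist z.1 z.2) (p, q) :=
    ((g.continuous.comp continuous_fst).sub (g.continuous.comp continuous_snd)).continuousAt.div
      continuous_dist.continuousAt hc.ne'
  obtain ⟨ε, hε, H⟩ := Metric.continuousAt_iff.mp hcont η hη
  have main : ∀ x y, (x, y) ∈ nearPair p q → (dist x p < min ε (dist p q / 3) ∨
      dist x q < min ε (dist p q / 3)) → (dist y p < min ε (dist p q / 3) ∨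
      dist y q < min ε (dist p q / 3)) →
      |(g x - g y) / dist x y - (g p - g q) / dist p q| ≤ η := by
    rintro x y ⟨hx, hy⟩ hx' hy'
    simp only at hx hy
    simp only [lt_min_iff] at hx' hy'
    -- The alternative that `x` is near `q` is excluded: the balls of radius `d(p,q)/3` are
    -- disjoint.
    have h1 : dist x p < ε := hx'.elim And.left fun h => by
      linarith [dist_triangle_left p q x]
    have h2 : dist y q < ε := hy'.symm.elim And.left fun h => by
      linarith [dist_triangle_left p q y]
    exact (H (x := (x, y)) (max_lt h1 h2)).le
  refine ⟨min ε (dist p q / 3), lt_min hε (by linarith), fun x y hx hy => ?_⟩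
  rw [BddFun.sub_apply, BddFun.sub_apply, BddFun.smul_apply]
  by_cases h1 : (x, y) ∈ nearPair p q
  · rw [hT _ (Or.inl h1), pairSign_of_mem h1, sub_zero, mul_one]
    exact main x y h1 hx hy
  · by_cases h2 : (x, y) ∈ nearPair q p
    · rw [hT _ (Or.inr h2), pairSign_of_mem_swap h2, sub_zero, deLeeuw_apply]
      have h3 : (y, x) ∈ nearPair p q := by
        obtain ⟨h3, h4⟩ := h2
        rw [dist_comm q p] at h3 h4
        exact ⟨h4, h3⟩
      have h4 := main y x h3 hy hx
      rw [← abs_neg, dist_comm y x] at h4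
      convert h4 using 2
      ring
    · rw [hT' _ (by simp [h1, h2]), pairSign_of_notMem h1 h2]
      simpa using hη.le

/-- The distance to `q`, truncated so as to be constant near `p` and near `q`. -/
noncomputable def stepLip (e p q : X) : LipZero e :=
  ofLipschitz e (fun x => max (min (dist x q) (2 * (dist p q / 3))) (dist p q / 3)) 1 zero_le_one
    fun x y => by
      rw [one_mul]
      refine (abs_max_sub_max_le_max _ _ _ _).trans (max_le ?_ (by simp))
      exact (abs_min_sub_min_le_max _ _ _ _).trans (max_le (abs_dist_sub_le x y q) (by simp))

/-- The step function is flat near `p` and near `q`, so its diagonal part is invisible to `M`; `1 /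
3` is its slope on `(p, q)`. This isolates `M (pairSign p q)`. -/
theorem map_deLeeuw_stepLip (hpq : p ≠ q) (hM : ∀ h, |M h| ≤ ‖h‖)
    (hpeak : ∀ f : LipZero e, ‖f‖ ≤ 1 → f p - f q = dist p q → M (deLeeuw e f) = 1)
    (hbtw : ¬ ∃ r : X, LiesStrictlyBetween p q r) :
    M (deLeeuw e (stepLip e p q)) = 1 / 3 * M (pairSign p q) := by
  have hc : 0 < dist p q := dist_pos.mpr hpq
  have hp : ∀ x, dist x p < dist p q / 3 →
      max (min (dist x q) (2 * (dist p q / 3))) (dist p q / 3) = 2 * (dist p q / 3) := by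
    intro x hx
    rw [min_eq_right (by linarith [dist_triangle_left p q x]), max_eq_left (by linarith)]
  have hq : ∀ x, dist x q < dist p q / 3 →
      max (min (dist x q) (2 * (dist p q / 3))) (dist p q / 3) = dist p q / 3 := by
    intro x hx
    rw [max_eq_right ((min_le_left _ _).trans hx.le)]
  obtain ⟨T, hT, hT'⟩ := exists_diagonal_part p q (stepLip e p q)
  have hT0 : M T = 0 := by
    refine map_eq_zero_of_eq_zero_near hM hpeak hbtw (ε := dist p q / 3) (by linarith) ?_
    intro x y hx hy
    by_cases hz : (x, y) ∈ nearPair p q ∪ nearPair q p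
    · exact hT _ hz
    · rw [hT' _ hz, deLeeuw_apply, stepLip, ofLipschitz_sub]
      simp only [nearPair, Set.mem_union, Set.mem_ofPred_eq, dist_comm q p] at hz
      rcases hx with hx | hx <;> rcases hy with hy | hy
      · rw [hp x hx, hp y hy, sub_self, zero_div]
      · exact absurd (Or.inl ⟨hx, hy⟩) hz
      · exact absurd (Or.inr ⟨hx, hy⟩) hz
      · rw [hq x hx, hq y hy, sub_self, zero_div]
  rw [map_deLeeuw_eq hpq hM hpeak hbtw (stepLip e p q) hT hT', hT0, add_zero, stepLip,
    ofLipschitz_sub, hp p (by simpa using hc), hq q (by simpa using hc)]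
  congr 1
  field_simp
  norm_num

/-- Now `M` attains its norm at `pairSign`, which vanishes wherever `T` may be nonzero, so the
diagonal part contributes nothing. -/
theorem map_deLeeuw_of_map_pairSign (hpq : p ≠ q) (hM : ∀ h, |M h| ≤ ‖h‖)
    (hpeak : ∀ f : LipZero e, ‖f‖ ≤ 1 → f p - f q = dist p q → M (deLeeuw e f) = 1)
    (hbtw : ¬ ∃ r : X, LiesStrictlyBetween p q r) (hsign : M (pairSign p q) = 1)
    (g : LipZero e) : M (deLeeuw e g) = (g p - g q) / dist p q := by
  obtain ⟨T, hT, hT'⟩ := exists_diagonal_part p q g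
  have hT0 : M T = 0 := by
    refine BddFun.map_eq_zero_of_abs_le_one_sub hM (norm_pairSign_le p q) hsign one_pos
      fun z hz => ?_
    have hz' : z ∉ nearPair p q ∪ nearPair q p := fun h => hz (hT z h)
    rw [Set.mem_union, not_or] at hz'
    simp [pairSign_of_notMem hz'.1 hz'.2]
  rw [map_deLeeuw_eq hpq hM hpeak hbtw g hT hT', hsign, hT0, mul_one, add_zero]

end Face

/-- If no point lies strictly between `p` and `q`, then the functional `u_{pq}` is an extreme point
of the unit ball of `Lip₀(X)*`. -/
theorem eq_of_convex_combination [CompactSpace X] {p q : X} (hpq : p ≠ q)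
    (hbtw : ¬ ∃ r : X, LiesStrictlyBetween p q r) {μ ν : StrongDual ℝ (LipZero e)}
    (hμ : ‖μ‖ ≤ 1) (hν : ‖ν‖ ≤ 1) {s t : ℝ} (hs : 0 < s) (ht : 0 < t) (hst : s + t = 1)
    (h : ∀ f, s * μ f + t * ν f = (f p - f q) / dist p q) (g : LipZero e) :
    μ g = (g p - g q) / dist p q := by
  have hc : 0 < dist p q := dist_pos.mpr hpq
  have split : ∀ {a b : ℝ}, a ≤ 1 → b ≤ 1 → s * a + t * b = 1 → a = 1 ∧ b = 1 := by
    intro a b ha hb hab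
    have h1 : s * (1 - a) + t * (1 - b) = 0 := by linarith
    have h2 := mul_nonneg hs.le (sub_nonneg.mpr ha)
    have h3 := mul_nonneg ht.le (sub_nonneg.mpr hb)
    have h4 := (mul_eq_zero.mp (show s * (1 - a) = 0 by linarith)).resolve_left hs.ne'
    have h5 := (mul_eq_zero.mp (show t * (1 - b) = 0 by linarith)).resolve_left ht.ne'
    exact ⟨by linarith, by linarith⟩
  obtain ⟨M, hM, hMμ⟩ := exists_deLeeuw_extension μ hμ
  obtain ⟨N, hN, hNν⟩ := exists_deLeeuw_extension ν hν
  have hle : ∀ {L : BddFun (X × X) →L[ℝ] ℝ}, (∀ h, |L h| ≤ ‖h‖) → ∀ {k : BddFun (X × X)},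
      ‖k‖ ≤ 1 → L k ≤ 1 := fun hL k hk => (le_abs_self _).trans ((hL k).trans hk)
  have hpeak : ∀ f : LipZero e, ‖f‖ ≤ 1 → f p - f q = dist p q →
      M (deLeeuw e f) = 1 ∧ N (deLeeuw e f) = 1 := by
    intro f hf hfd
    have hf' : ‖deLeeuw e f‖ ≤ 1 := by rwa [LinearIsometry.norm_map]
    refine split (hle hM hf') (hle hN hf') ?_
    rw [hMμ, hNν, h, hfd, div_self hc.ne']
  have hpM := fun f hf hfd => (hpeak f hf hfd).1
  have hpN := fun f hf hfd => (hpeak f hf hfd).2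
  -- Evaluating the convex combination at the step function gives `s * M (pairSign p q) + t * N
  -- (pairSign p q) = 1`, with both values at most one.
  have hsign : M (pairSign p q) = 1 := by
    refine (split (hle hM (norm_pairSign_le p q)) (hle hN (norm_pairSign_le p q)) ?_).1
    have h1 := map_deLeeuw_stepLip hpq hM hpM hbtw
    have h2 := map_deLeeuw_stepLip hpq hN hpN hbtw
    have h3 := h (stepLip e p q)
    have h4 : (stepLip e p q p - stepLip e p q q) / dist p q = 1 / 3 := by
      rw [stepLip, ofLipschitz_sub, dist_self, min_eq_right (by linarith),
        max_eq_left (by linarith), max_eq_right (by rw [min_eq_left] <;> linarith)]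
      field_simp
      norm_num
    rw [← hMμ, ← hNν, h1, h2, h4] at h3
    linarith
  rw [← hMμ]
  exact map_deLeeuw_of_map_pairSign hpq hM hpM hbtw hsign g

end LipZero

/-- The topological dual of a normed space. Unlike `StrongDual`, it fixes the topology and the module
structure to be those that come from the norm, which steers instance search on `LipFree`. -/
abbrev NormDual (E : Type*) [NormedAddCommGroup E] [NormedSpace ℝ E] : Type _ := StrongDual ℝ E

/-! ### The Lipschitz-free space, its dual, and the extreme points -/

namespace LipFree

variable {X : Type*} [MetricSpace X] {e : X}

theorem norm_j_sub_le (x y : X) : ‖j e x - j e y‖ ≤ dist x y := by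
  change ‖LipZero.eval e x - LipZero.eval e y‖ ≤ _
  refine ContinuousLinearMap.opNorm_le_bound _ dist_nonneg fun f => ?_
  rw [mul_comm]
  exact f.abs_sub_le x y

theorem norm_j_sub (x y : X) : ‖j e x - j e y‖ = dist x y := by
  refine le_antisymm (norm_j_sub_le x y) ?_
  have h1 := (LipZero.eval e x - LipZero.eval e y).le_opNorm (LipZero.plateauLip e x y 0)
  have h2 : (LipZero.eval e x - LipZero.eval e y) (LipZero.plateauLip e x y 0) = dist x y :=
    LipZero.plateauLip_peak x y le_rfl
  rw [h2, Real.norm_of_nonneg dist_nonneg] at h1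
  exact h1.trans (mul_le_of_le_one_right (norm_nonneg _) (LipZero.norm_plateauLip_le x y 0))

theorem u_apply (p q : X) (f : LipZero e) :
    (u e p q : StrongDual ℝ (LipZero e)) f = (f p - f q) / dist p q := by
  rw [u, norm_j_sub, div_eq_inv_mul]
  rfl

theorem norm_u {p q : X} (hpq : p ≠ q) : ‖u e p q‖ = 1 := by
  refine norm_smul_inv_norm (𝕜 := ℝ) (E := LipFree e) ?_
  refine (norm_ne_zero_iff (E := LipFree e)).mp ?_
  rw [norm_j_sub]
  exact (dist_pos.mpr hpq).ne'

theorem mem_closedBall_iff (γ : LipFree e) :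
    γ ∈ Metric.closedBall (0 : LipFree e) 1 ↔ ‖γ‖ ≤ 1 := by
  have h : dist γ 0 = ‖γ‖ := dist_zero_right γ
  rw [Metric.mem_closedBall, h]

theorem u_mem_closedBall {p q : X} (hpq : p ≠ q) :
    u e p q ∈ Metric.closedBall (0 : LipFree e) 1 :=
  (mem_closedBall_iff _).mpr (norm_u hpq).le

theorem j_base : j e e = 0 :=
  Subtype.ext (ContinuousLinearMap.ext fun f => f.apply_base)

/-- Evaluation at a Lipschitz function, as a functional on the Lipschitz-free space. -/
noncomputable def pairing (e : X) : LipZero e →L[ℝ] NormDual (LipFree e) :=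
  (LipFree e).subtypeL.flip

@[simp] theorem pairing_apply (f : LipZero e) (γ : LipFree e) :
    pairing e f γ = (γ : StrongDual ℝ (LipZero e)) f := rfl

theorem norm_pairing_le (f : LipZero e) : ‖pairing e f‖ ≤ ‖f‖ := by
  refine ContinuousLinearMap.opNorm_le_bound _ (norm_nonneg f) fun γ => ?_
  rw [mul_comm]
  exact (γ : StrongDual ℝ (LipZero e)).le_opNorm f

theorem ext_on_j {φ ψ : NormDual (LipFree e)} (h : ∀ x, φ (j e x) = ψ (j e x)) : φ = ψ := by
  refine ContinuousLinearMap.ext fun γ => ?_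
  let S : Submodule ℝ (LipFree e) := Submodule.span ℝ (Set.range (j e))
  have hS : S.map (LipFree e).subtype = Submodule.span ℝ (Set.range (LipZero.eval e)) := by
    rw [Submodule.map_span, ← Set.range_comp]
    rfl
  have hγ : γ ∈ closure (S : Set (LipFree e)) := by
    rw [closure_subtype]
    have h1 : ((↑) : LipFree e → StrongDual ℝ (LipZero e)) '' (S : Set (LipFree e)) =
        (Submodule.span ℝ (Set.range (LipZero.eval e)) : Set (StrongDual ℝ (LipZero e))) := by
      rw [← hS]
      rfl
    rw [h1]
    exact γ.2
  have hEq : Set.EqOn φ ψ (S : Set (LipFree e)) := fun δ hδ =>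
    LinearMap.eqOn_span (f := φ.toLinearMap) (g := ψ.toLinearMap)
      (by rintro _ ⟨x, rfl⟩; exact h x) hδ
  exact hEq.closure φ.continuous ψ.continuous hγ

/-- The dual of the Lipschitz-free space is `Lip₀(X)`. -/
theorem pairing_surjective : Function.Surjective (pairing e) := by
  intro φ
  refine ⟨LipZero.ofLipschitz e (fun x => φ (j e x)) ‖φ‖ (norm_nonneg φ) fun x y => ?_,
    ext_on_j fun x => ?_⟩
  · rw [← map_sub]
    exact (φ.le_opNorm _).trans (mul_le_mul_of_nonneg_left (norm_j_sub_le x y) (norm_nonneg φ))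
  · change φ (j e x) - φ (j e e) = φ (j e x)
    rw [j_base, map_zero, sub_zero]

variable {p q : X}

theorem u_mem_extremePoints [CompactSpace X] (hpq : p ≠ q)
    (hbtw : ¬ ∃ r : X, LiesStrictlyBetween p q r) :
    u e p q ∈ Set.extremePoints ℝ (Metric.closedBall (0 : LipFree e) 1) := by
  refine mem_extremePoints_iff_left.mpr ⟨u_mem_closedBall hpq, ?_⟩
  rintro γ hγ δ hδ ⟨s, t, hs, ht, hst, h⟩
  rw [mem_closedBall_iff] at hγ hδ
  refine Subtype.ext (ContinuousLinearMap.ext fun g => ?_)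
  rw [u_apply]
  refine LipZero.eq_of_convex_combination hpq hbtw hγ hδ hs ht hst (fun f => ?_) g
  rw [← u_apply, ← h]
  rfl

/-- Composing with `pairing` moves the bidual ball into that of `Lip₀(X)*`; as `pairing` is onto,
nothing is lost. -/
theorem inclusionInDoubleDual_u_mem_extremePoints [CompactSpace X] (hpq : p ≠ q)
    (hbtw : ¬ ∃ r : X, LiesStrictlyBetween p q r) :
    NormedSpace.inclusionInDoubleDual ℝ (LipFree e) (u e p q) ∈
      Set.extremePoints ℝ (Metric.closedBall (0 : NormDual (NormDual (LipFree e))) 1) := by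
  refine mem_extremePoints_iff_left.mpr ⟨?_, ?_⟩
  · refine (mem_closedBall_zero_iff (E := NormDual (NormDual (LipFree e)))).mpr ?_
    exact (NormedSpace.double_dual_bound ℝ (LipFree e) _).trans (norm_u hpq).le
  · rintro ξ hξ ζ hζ ⟨s, t, hs, ht, hst, h⟩
    replace hξ : ‖ξ‖ ≤ 1 :=
      (mem_closedBall_zero_iff (E := NormDual (NormDual (LipFree e)))).mp hξ
    replace hζ : ‖ζ‖ ≤ 1 :=
      (mem_closedBall_zero_iff (E := NormDual (NormDual (LipFree e)))).mp hζ
    have hcomp : ∀ {ω : NormDual (NormDual (LipFree e))}, ‖ω‖ ≤ 1 →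
        ‖ω.comp (pairing e)‖ ≤ 1 := fun {ω} hω =>
      ContinuousLinearMap.opNorm_le_bound _ zero_le_one fun f =>
        (ω.le_opNorm _).trans (mul_le_mul hω (norm_pairing_le f) (norm_nonneg _) zero_le_one)
    refine ContinuousLinearMap.ext fun φ => ?_
    obtain ⟨g, rfl⟩ := pairing_surjective φ
    rw [NormedSpace.dual_def, pairing_apply, u_apply]
    refine LipZero.eq_of_convex_combination hpq hbtw (hcomp hξ) (hcomp hζ) hs ht hst
      (fun f => ?_) g
    rw [← u_apply]
    exact congrArg (fun ω : NormDual (NormDual (LipFree e)) => ω (pairing e f)) h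

theorem not_liesStrictlyBetween_of_mem_extremePoints (hpq : p ≠ q)
    (hu : u e p q ∈ Set.extremePoints ℝ (Metric.closedBall (0 : LipFree e) 1)) :
    ¬ ∃ r : X, LiesStrictlyBetween p q r := by
  rintro ⟨r, hr, hrp, hrq⟩
  have hc : 0 < dist p q := dist_pos.mpr hpq
  have h1 : 0 < dist p r := dist_pos.mpr hrp.symm
  have h2 : 0 < dist r q := dist_pos.mpr hrq
  have heq : u e p r = u e p q := by
    refine hu.2 (x₁ := u e p r) (x₂ := u e r q) (u_mem_closedBall hrp.symm)
      (u_mem_closedBall hrq)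
      ⟨dist p r / dist p q, dist r q / dist p q, by positivity, by positivity, ?_, ?_⟩
    · rw [← add_div, hr, div_self hc.ne']
    · refine Subtype.ext (ContinuousLinearMap.ext fun f => ?_)
      change dist p r / dist p q * (u e p r : StrongDual ℝ (LipZero e)) f +
        dist r q / dist p q * (u e r q : StrongDual ℝ (LipZero e)) f = _
      rw [u_apply, u_apply, u_apply]
      field_simp
      ring
  -- This function rises by `d(p,r)` from `p` to `r` and no further at `q`, so `u_{pr} = u_{pq}`
  -- would force `d(p,r) = d(p,q)`.
  have hf : ∀ x y, |min (dist x p) (dist p r) - min (dist y p) (dist p r)| ≤ 1 * dist x y :=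
    fun x y => by
      rw [one_mul]
      exact (abs_min_sub_min_le_max _ _ _ _).trans (max_le (abs_dist_sub_le x y p) (by simp))
  have h3 := congrArg (fun γ : LipFree e => (γ : StrongDual ℝ (LipZero e))
    (LipZero.ofLipschitz e (fun x => min (dist x p) (dist p r)) 1 zero_le_one hf)) heq
  simp only [u_apply, LipZero.ofLipschitz_sub, dist_self, dist_comm r p, dist_comm q p] at h3
  rw [min_self, min_eq_left h1.le, min_eq_right (by linarith), zero_sub, neg_div, neg_div,
    div_self h1.ne', neg_inj, eq_div_iff hc.ne'] at h3
  linarith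

end LipFree

theorem theorem4p2 {X : Type*} [MetricSpace X] [CompactSpace X] (e p q : X) (hpq : p ≠ q) :
    List.TFAE
      [IsPreservedExtremePoint (LipFree.u e p q),
       LipFree.u e p q ∈ Set.extremePoints ℝ (Metric.closedBall (0 : LipFree e) 1),
       ¬ ∃ r : X, LiesStrictlyBetween p q r] := by
  tfae_have 1 → 2 := And.left
  tfae_have 2 → 3 := LipFree.not_liesStrictlyBetween_of_mem_extremePoints hpq
  tfae_have 3 → 1 := fun h =>
    ⟨LipFree.u_mem_extremePoints hpq h, LipFree.inclusionInDoubleDual_u_mem_extremePoints hpq h⟩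
  tfae_finish
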